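/- Let $\kappa$ be a regular cardinal and let $\mathsf A$ be a $\kappa$-accessible category (that is, $\mathsf A$ has $\kappa$-directed colimits and there is a set of $\kappa$-presentable objects such that every object of $\mathsf A$ is a $\kappa$-directed colimit of objects from this set). Let $\mathsf A_{<\kappa}\subset\mathsf A$ be the full subcategory of $\kappa$-presentable objects, and let $\mathsf A^{\to}$ be the category of morphisms of $\mathsf A$. A class of morphisms $\mathcal P$ in a category $\mathsf C$ is called a QE-epi class if (i) for all morphisms $p\colon D\to E$ in $\mathcal P$ and $f\colon E'\to E$ in $\mathsf C$ the pullback $D'=D\times_E E'$ exists, and the morphism $D'\to E'$ belongs to $\mathcal P$; (ii) every morphism in $\mathcal P$ is the coequalizer of its kernel pair; (iii) $\mathcal P$ contains all identity morphisms and is closed under composition. For such a class, a $\mathcal P$-sequence is a diagram $K\rightrightarrows D\xrightarrow{\,p\,}E$ in which $p\in\mathcal P$ and $K\rightrightarrows D$ is the kernel pair of $p$. A QE-epi class $\mathcal P$ in $\mathsf A$ is called strongly locally $\kappa$-coherent if (a) the $\mathcal P$-sequences are precisely all the $\kappa$-directed colimits of $\mathcal P$-sequences whose three terms $K$, $D$,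 $E$ all belong to $\mathsf A_{<\kappa}$, the colimits being taken in the category of diagrams in $\mathsf A$ consisting of a parallel pair $K\rightrightarrows D$ and a morphism $D\to E$ with equal compositions $K\rightrightarrows D\to E$; and (b) for every pullback square $D'=D\times_E E'$ in $\mathsf A$ of a morphism $p\colon D\to E$ in $\mathcal P$ along a morphism $E'\to E$, if $D$, $E$, $E'$ are $\kappa$-presentable, then so is $D'$. Theorem. Let $\mathcal Q$ be a QE-epi class in the category $\mathsf A_{<\kappa}$. Then the class of all $\kappa$-directed colimits in $\mathsf A^{\to}$ of morphisms from $\mathcal Q$ is a strongly locally $\kappa$-coherent QE-epi class in $\mathsf A$. -/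

import Mathlib

open CategoryTheory CategoryTheory.Limits

universe w v u

/-- A class of morphisms `P` of a category `C` is a *QE-epi class* if
* all pullbacks of morphisms from `P` exist, and `P` is stable under pullbacks;
* every morphism from `P` is the coequalizer of its kernel pair;
* `P` contains the identities and is closed under composition. -/
structure IsQEEpiClass {C : Type u} [Category.{v} C] (P : MorphismProperty C) : Prop where
  hasPullback : ∀ {D E E' : C} (p : D ⟶ E) (f : E' ⟶ E), P p → HasPullback p f
  of_isPullback : ∀ {D E D' E' : C} {p : D ⟶ E} {f : E' ⟶ E} {f' : D' ⟶ D} {p' : D' ⟶ E'},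
    IsPullback f' p' p f → P p → P p'
  isCoequalizer : ∀ {K D E : C} {p : D ⟶ E} {k₁ k₂ : K ⟶ D}, P p →
    ∀ h : IsKernelPair p k₁ k₂, Nonempty (IsColimit (Cofork.ofπ p h.w))
  id_mem : ∀ X : C, P (𝟙 X)
  comp_mem : ∀ {X Y Z : C} (f : X ⟶ Y) (g : Y ⟶ Z), P f → P g → P (f ≫ g)

/-- The class of all `κ`-directed colimits of objects from `T`: the colimits (whenever they exist)
of diagrams of objects from `T` indexed by (small) `κ`-directed posets. -/
def kDirectedColimits {C : Type u} [Category.{v} C] (κ : Cardinal.{w}) [Fact κ.IsRegular]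
    (T : ObjectProperty C) : ObjectProperty C :=
  fun X => ∃ (J : Type w) (_ : PartialOrder J) (_ : IsCardinalFiltered J κ), T.colimitsOfShape J X

/-- A class of morphisms in `C` viewed as a class of objects of the category of morphisms
of `C`. -/
def arrowClass {C : Type u} [Category.{v} C] (P : MorphismProperty C) :
    ObjectProperty (Arrow C) :=
  fun f => P f.hom

/-- A class of morphisms in the full subcategory of objects satisfying `S`, viewed as a class
of morphisms in the ambient category. -/
def ambientClass {C : Type u} [Category.{v} C] {S : ObjectProperty C}
    (Q : MorphismProperty S.FullSubcategory) : MorphismProperty C :=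
  fun X Y f => ∃ (hX : S X) (hY : S Y),
    Q (ObjectProperty.homMk f : (⟨X, hX⟩ : S.FullSubcategory) ⟶ ⟨Y, hY⟩)

/-- The class of all `κ`-directed colimits, taken in the category of morphisms of `A`,
of morphisms from a class `Q` of morphisms between `κ`-presentable objects of `A`. -/
def directedColimitClass {A : Type u} [Category.{v} A] (κ : Cardinal.{w}) [Fact κ.IsRegular]
    (Q : MorphismProperty (isCardinalPresentable A κ).FullSubcategory) : MorphismProperty A :=
  fun _ _ f => kDirectedColimits κ (arrowClass (ambientClass Q)) (Arrow.mk f)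

/-- The objects of the finite indexing category `K ⇉ D ⟶ E`. -/
inductive WalkingSeq : Type
  | K
  | D
  | E

/-- The morphisms of the finite indexing category `K ⇉ D ⟶ E`: besides the identities there
are `k₁ k₂ : K ⟶ D`, `p : D ⟶ E` and `kp : K ⟶ E`, the latter being both `k₁ ≫ p` and `k₂ ≫ p`. -/
inductive WalkingSeq.Hom : WalkingSeq → WalkingSeq → Type
  | id (X : WalkingSeq) : WalkingSeq.Hom X X
  | k₁ : WalkingSeq.Hom K D
  | k₂ : WalkingSeq.Hom K D
  | p : WalkingSeq.Hom D E
  | kp : WalkingSeq.Hom K E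

/-- Composition in the indexing category `K ⇉ D ⟶ E`. -/
def WalkingSeq.Hom.comp : ∀ {X Y Z : WalkingSeq}, WalkingSeq.Hom X Y → WalkingSeq.Hom Y Z →
    WalkingSeq.Hom X Z
  | _, _, _, .id _, g => g
  | _, _, _, .k₁, .id _ => .k₁
  | _, _, _, .k₁, .p => .kp
  | _, _, _, .k₂, .id _ => .k₂
  | _, _, _, .k₂, .p => .kp
  | _, _, _, .p, .id _ => .p
  | _, _, _, .kp, .id _ => .kp

instance WalkingSeq.smallCategory : SmallCategory WalkingSeq where
  Hom := WalkingSeq.Hom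
  id := WalkingSeq.Hom.id
  comp := WalkingSeq.Hom.comp
  id_comp _ := rfl
  comp_id f := by cases f <;> rfl
  assoc f g h := by cases f <;> cases g <;> cases h <;> rfl

/-- The first arrow `K ⟶ D` of the indexing category. -/
def WalkingSeq.fst : WalkingSeq.K ⟶ WalkingSeq.D := WalkingSeq.Hom.k₁

/-- The second arrow `K ⟶ D` of the indexing category. -/
def WalkingSeq.snd : WalkingSeq.K ⟶ WalkingSeq.D := WalkingSeq.Hom.k₂

/-- The arrow `D ⟶ E` of the indexing category. -/
def WalkingSeq.quo : WalkingSeq.D ⟶ WalkingSeq.E := WalkingSeq.Hom.p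

theorem WalkingSeq.condition :
    WalkingSeq.fst ≫ WalkingSeq.quo = WalkingSeq.snd ≫ WalkingSeq.quo := rfl

/-- A diagram `k₁, k₂ : K ⇉ D`, `p : D ⟶ E` in `C` is a *`P`-sequence* if `p` belongs to `P` and
`(k₁, k₂)` is the kernel pair of `p`. -/
def IsPSequence {C : Type u} [Category.{v} C] (P : MorphismProperty C) :
    ObjectProperty (WalkingSeq ⥤ C) :=
  fun F => P (F.map WalkingSeq.quo) ∧
    IsKernelPair (F.map WalkingSeq.quo) (F.map WalkingSeq.fst) (F.map WalkingSeq.snd)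

/-- A class of morphisms `P` in `A` is a *strongly locally `κ`-coherent QE-epi class* if
* it is a QE-epi class;
* it is locally `κ`-coherent: the `P`-sequences are precisely all the `κ`-directed colimits
  (in the diagram category) of `P`-sequences with all three terms `κ`-presentable;
* in every pullback square of a morphism `p : D ⟶ E` from `P` along a morphism `f : E' ⟶ E`
  with `D`, `E`, `E'` being `κ`-presentable, the fourth object `D'` is `κ`-presentable. -/
structure IsStronglyLocallyCoherentQEEpiClass {A : Type u} [Category.{v} A] (κ : Cardinal.{w})
    [Fact κ.IsRegular] (P : MorphismProperty A) : Prop extends IsQEEpiClass P where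
  isPSequence_iff : ∀ F : WalkingSeq ⥤ A, IsPSequence P F ↔
    kDirectedColimits κ
      (fun G : WalkingSeq ⥤ A => IsPSequence P G ∧ ∀ j, IsCardinalPresentable (G.obj j) κ) F
  isCardinalPresentable_of_isPullback : ∀ {D E D' E' : A} {p : D ⟶ E} {f : E' ⟶ E}
    {f' : D' ⟶ D} {p' : D' ⟶ E'}, IsPullback f' p' p f → P p →
    IsCardinalPresentable D κ → IsCardinalPresentable E κ → IsCardinalPresentable E' κ →
    IsCardinalPresentable D' κ

/-! ### Pullbacks and arrows tested on `κ`-presentable objects -/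

section

variable {A : Type u} [Category.{w} A] {κ : Cardinal.{w}} [Fact κ.IsRegular]

/-! The proof rests on a factorization criterion, `directedColimitClass_iff`: membership of `f` in
the class is decided by factoring squares from arrows between `κ`-presentable objects to `f` through
morphisms from `Q`. Such arrows are `κ`-presentable in the arrow category, and every arrow is a
`κ`-directed colimit of them, so the general lemma `kDirectedColimits_of_factorization` applies
there. Identities, composition, base change and closure under `κ`-filtered colimits then reduce to
diagram chases with pullbacks of morphisms from `Q`.

These chases take place in `A` because `κ`-presentable objects detect pullbacks: pullbacks in the
subcategory stay pullbacks in `A`, and `κ`-filtered colimits of pullback squares are pullback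
squares. Existence of pullbacks follows by presenting `p` and `f` over one directed index
(`LiftIndex`) and taking the colimit of the levelwise pullbacks. The coequalizer property is first
transferred from the subcategory to `A`, then glued along a presentation of `p`.

For coherence, the kernel pair of a colimit of morphisms from `Q` is the colimit of their kernel
pairs, which are `κ`-presentable. Strong coherence is a retract argument. -/

theorem exists_colimitOfShape_presentable [IsCardinalAccessibleCategory A κ] (X : A) :
    ∃ (J : Type w) (_ : PartialOrder J) (_ : IsCardinalFiltered J κ),
      Nonempty ((isCardinalPresentable A κ).ColimitOfShape J X) := by
  obtain ⟨J, _, _, hX⟩ :=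
    (isCardinalFilteredGenerator_isCardinalPresentable A κ).exists_colimitsOfShape X
  -- A `κ`-filtered category receives a final functor from a `κ`-directed poset, so the index may be
  -- taken to be a poset.
  obtain ⟨α, _, _, F, _⟩ := IsCardinalFiltered.exists_cardinal_directed J κ
  exact ⟨α, inferInstance, inferInstance, ObjectProperty.colimitsOfShape_le_of_final _ F _ hX⟩

theorem hom_ext_of_presentable (κ : Cardinal.{w}) [Fact κ.IsRegular]
    [IsCardinalAccessibleCategory A κ] {X Y : A} {f g : X ⟶ Y}
    (h : ∀ (S : A) [IsCardinalPresentable S κ] (s : S ⟶ X), s ≫ f = s ≫ g) : f = g := by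
  obtain ⟨J, _, _, ⟨p⟩⟩ := exists_colimitOfShape_presentable (κ := κ) X
  refine p.isColimit.hom_ext fun j => ?_
  have : IsCardinalPresentable _ κ := p.prop_diag_obj j
  exact h _ _

/-- In a `κ`-accessible category, pullback squares can be tested on `κ`-presentable objects. -/
theorem isPullback_of_presentable (κ : Cardinal.{w}) [Fact κ.IsRegular]
    [IsCardinalAccessibleCategory A κ]
    {P X Y Z : A} {fst : P ⟶ X} {snd : P ⟶ Y} {f : X ⟶ Z} {g : Y ⟶ Z}
    (w : fst ≫ f = snd ≫ g)
    (hex : ∀ (S : A) [IsCardinalPresentable S κ] (a : S ⟶ X) (b : S ⟶ Y), a ≫ f = b ≫ g →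
      ∃ l : S ⟶ P, l ≫ fst = a ∧ l ≫ snd = b)
    (huniq : ∀ (S : A) [IsCardinalPresentable S κ] (l l' : S ⟶ P), l ≫ fst = l' ≫ fst →
      l ≫ snd = l' ≫ snd → l = l') :
    IsPullback fst snd f g := by
  have ext : ∀ (S : A) (l l' : S ⟶ P), l ≫ fst = l' ≫ fst → l ≫ snd = l' ≫ snd → l = l' :=
    fun S l l' h₁ h₂ => hom_ext_of_presentable κ fun T _ s =>
      huniq T _ _ (by simp [h₁]) (by simp [h₂])
  have ex : ∀ (S : A) (a : S ⟶ X) (b : S ⟶ Y), a ≫ f = b ≫ g →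
      ∃ l : S ⟶ P, l ≫ fst = a ∧ l ≫ snd = b := by
    intro S a b hab
    obtain ⟨J, _, _, ⟨p⟩⟩ := exists_colimitOfShape_presentable (κ := κ) S
    have (j : J) : IsCardinalPresentable (p.diag.obj j) κ := p.prop_diag_obj j
    choose l hl₁ hl₂ using fun j => hex (p.diag.obj j) (p.ι.app j ≫ a) (p.ι.app j ≫ b)
      (by simp [hab])
    -- Uniqueness of lifts makes the lifts chosen on the terms of the presentation compatible.
    let c : Cocone p.diag :=
      { pt := P
        ι :=
          { app := l
            naturality i j φ := by
              have := p.ι.naturality φ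
              refine ext _ _ _ ?_ ?_ <;> simp_all [reassoc_of% this] } }
    refine ⟨p.isColimit.desc c, p.isColimit.hom_ext fun j => ?_,
      p.isColimit.hom_ext fun j => ?_⟩
    · rw [p.isColimit.fac_assoc]; exact hl₁ j
    · rw [p.isColimit.fac_assoc]; exact hl₂ j
  refine ⟨⟨w⟩, ⟨PullbackCone.IsLimit.mk w
    (fun s => (ex _ s.fst s.snd s.condition).choose)
    (fun s => (ex _ s.fst s.snd s.condition).choose_spec.1)
    (fun s => (ex _ s.fst s.snd s.condition).choose_spec.2)
    (fun s m h₁ h₂ => ext _ _ _ ?_ ?_)⟩⟩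
  · rw [h₁, (ex _ s.fst s.snd s.condition).choose_spec.1]
  · rw [h₂, (ex _ s.fst s.snd s.condition).choose_spec.2]

/-- In a `κ`-accessible category, `κ`-filtered colimits of pullback squares are pullback
squares. -/
theorem isPullback_of_isColimit (κ : Cardinal.{w}) [Fact κ.IsRegular]
    [IsCardinalAccessibleCategory A κ] {J : Type w} [SmallCategory J] [IsCardinalFiltered J κ]
    {P X Y Z : J ⥤ A} {fst : P ⟶ X} {snd : P ⟶ Y} {f : X ⟶ Z} {g : Y ⟶ Z}
    (sq : ∀ j, IsPullback (fst.app j) (snd.app j) (f.app j) (g.app j))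
    {cP : Cocone P} {cX : Cocone X} {cY : Cocone Y} {cZ : Cocone Z}
    (hP : IsColimit cP) (hX : IsColimit cX) (hY : IsColimit cY) (hZ : IsColimit cZ)
    {fst' : cP.pt ⟶ cX.pt} {snd' : cP.pt ⟶ cY.pt} {f' : cX.pt ⟶ cZ.pt} {g' : cY.pt ⟶ cZ.pt}
    (h₁ : ∀ j, cP.ι.app j ≫ fst' = fst.app j ≫ cX.ι.app j)
    (h₂ : ∀ j, cP.ι.app j ≫ snd' = snd.app j ≫ cY.ι.app j)
    (h₃ : ∀ j, cX.ι.app j ≫ f' = f.app j ≫ cZ.ι.app j)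
    (h₄ : ∀ j, cY.ι.app j ≫ g' = g.app j ≫ cZ.ι.app j) :
    IsPullback fst' snd' f' g' := by
  have := isFiltered_of_isCardinalFiltered J κ
  refine isPullback_of_presentable κ (hP.hom_ext fun j => ?_) (fun S _ a b hab => ?_)
    (fun S _ l l' hl hl' => ?_)
  · rw [reassoc_of% (h₁ j), reassoc_of% (h₂ j), h₃, h₄, reassoc_of% (sq j).w]
  · obtain ⟨i, a, rfl⟩ := IsCardinalPresentable.exists_hom_of_isColimit κ hX a
    obtain ⟨i', b, rfl⟩ := IsCardinalPresentable.exists_hom_of_isColimit κ hY b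
    simp only [Category.assoc, h₃, h₄] at hab
    obtain ⟨k, u, v, huv⟩ := IsCardinalPresentable.exists_eq_of_isColimit κ hZ
      (a ≫ f.app i) (b ≫ g.app i') (by simpa using hab)
    refine ⟨(sq k).lift (a ≫ X.map u) (b ≫ Y.map v) (by simpa using huv) ≫ cP.ι.app k, ?_, ?_⟩
    · simp [h₁]
    · simp [h₂]
  · obtain ⟨i, l, rfl⟩ := IsCardinalPresentable.exists_hom_of_isColimit κ hP l
    obtain ⟨i', l', rfl⟩ := IsCardinalPresentable.exists_hom_of_isColimit κ hP l'
    simp only [Category.assoc, h₁, h₂] at hl hl'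
    obtain ⟨k, u, v, huv⟩ := IsCardinalPresentable.exists_eq_of_isColimit κ hX
      (l ≫ fst.app i) (l' ≫ fst.app i') (by simpa using hl)
    obtain ⟨k', u', v', huv'⟩ := IsCardinalPresentable.exists_eq_of_isColimit κ hY
      (l ≫ snd.app i) (l' ≫ snd.app i') (by simpa using hl')
    -- One stage `m` where both projections agree; there the levelwise pullback property identifies
    -- the two maps.
    obtain ⟨m, x, y, hx, hy⟩ := IsFiltered.bowtie u u' v v'
    have e : l ≫ P.map (u ≫ x) = l' ≫ P.map (v ≫ x) := by
      refine (sq m).hom_ext ?_ ?_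
      · simpa using huv =≫ X.map x
      · rw [hx, hy]; simpa using huv' =≫ Y.map y
    simpa using e =≫ cP.ι.app m

/-- An arrow between `κ`-presentable objects is `κ`-presentable in the category of arrows. -/
theorem isCardinalPresentable_arrow [HasCardinalFilteredColimits A κ] (g : Arrow A)
    [IsCardinalPresentable g.left κ] [IsCardinalPresentable g.right κ] :
    IsCardinalPresentable g κ where
  preservesColimitOfShape J _ _ := ⟨fun {F} ↦ ⟨fun {c} hc ↦ ⟨by
    have := essentiallySmallSelf J
    have := isFiltered_of_isCardinalFiltered J κ
    have := HasCardinalFilteredColimits.hasColimitsOfShape (κ := κ) A J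
    have hl := isColimitOfPreserves Arrow.leftFunc hc
    have hr := isColimitOfPreserves Arrow.rightFunc hc
    refine Types.FilteredColimit.isColimitOf' _ _ (fun φ ↦ ?_) (fun j φ₁ φ₂ h ↦ ?_)
    · change g ⟶ c.pt at φ
      obtain ⟨i, a, ha⟩ := IsCardinalPresentable.exists_hom_of_isColimit κ hl φ.left
      obtain ⟨i', b, hb⟩ := IsCardinalPresentable.exists_hom_of_isColimit κ hr φ.right
      change g.left ⟶ (F.obj i).left at a
      change g.right ⟶ (F.obj i').right at b
      change a ≫ (c.ι.app i).left = φ.left at ha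
      change b ≫ (c.ι.app i').right = φ.right at hb
      -- The two components were lifted independently. Their square commutes in the colimit, hence
      -- at some stage since `g.left` is presentable.
      have e : (a ≫ (F.obj i).hom) ≫ (c.ι.app i).right = (g.hom ≫ b) ≫ (c.ι.app i').right := by
        have := Arrow.w (c.ι.app i)
        have := Arrow.w φ
        dsimp at *
        simp only [Category.assoc, hb, ← this, ← ha]
        simp_all
      obtain ⟨k, u, v, huv⟩ := IsCardinalPresentable.exists_eq_of_isColimit κ hr
        (a ≫ (F.obj i).hom) (g.hom ≫ b) e
      change (a ≫ (F.obj i).hom) ≫ (F.map u).right = (g.hom ≫ b) ≫ (F.map v).right at huv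
      refine ⟨k, Arrow.homMk (a ≫ (F.map u).left) (b ≫ (F.map v).right) (by simpa using huv), ?_⟩
      dsimp
      have hu := (Arrow.comp_left _ _).symm.trans (Arrow.hom.congr_left (c.w u))
      have hv := (Arrow.comp_right _ _).symm.trans (Arrow.hom.congr_right (c.w v))
      ext
      · rw [← ha, ← hu]; simp only [Arrow.comp_left, Arrow.homMk_left, Category.assoc]
      · rw [← hb, ← hv]; simp only [Arrow.comp_right, Arrow.homMk_right, Category.assoc]
    · change g ⟶ F.obj j at φ₁ φ₂
      change φ₁ ≫ c.ι.app j = φ₂ ≫ c.ι.app j at h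
      obtain ⟨k, u, hu⟩ := IsCardinalPresentable.exists_eq_of_isColimit' κ hl φ₁.left φ₂.left
        (Arrow.hom.congr_left h)
      obtain ⟨k', u', hu'⟩ := IsCardinalPresentable.exists_eq_of_isColimit' κ hr φ₁.right φ₂.right
        (Arrow.hom.congr_right h)
      obtain ⟨m, x, y, hxy⟩ := IsFiltered.span u u'
      change φ₁.left ≫ (F.map u).left = φ₂.left ≫ (F.map u).left at hu
      change φ₁.right ≫ (F.map u').right = φ₂.right ≫ (F.map u').right at hu'
      refine ⟨m, u ≫ x, ?_⟩
      change φ₁ ≫ F.map (u ≫ x) = φ₂ ≫ F.map (u ≫ x)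
      ext
      · simpa using hu =≫ (F.map x).left
      · rw [hxy]; simpa using hu' =≫ (F.map y).right⟩⟩⟩

end

/-! ### Presenting a morphism over a common directed index -/

section

variable {A : Type u} [Category.{w} A]

/-- Given diagrams `T` and `W` with cocones with points `X` and `Y` and a morphism `f : X ⟶ Y`,
the type of all lifts of `f` to a morphism from a term of `T` to a term of `W`. -/
structure LiftIndex {J J' : Type w} [PartialOrder J] [PartialOrder J'] {T : J ⥤ A} {W : J' ⥤ A}
    (c : Cocone T) (d : Cocone W) (f : c.pt ⟶ d.pt) : Type w where
  src : J
  tgt : J'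
  hom : T.obj src ⟶ W.obj tgt
  w : hom ≫ d.ι.app tgt = c.ι.app src ≫ f

namespace LiftIndex

variable {J J' : Type w} [PartialOrder J] [PartialOrder J'] {T : J ⥤ A} {W : J' ⥤ A}
  {c : Cocone T} {d : Cocone W} {f : c.pt ⟶ d.pt}

instance : PartialOrder (LiftIndex c d f) where
  le a b := ∃ (h : a.src ≤ b.src) (h' : a.tgt ≤ b.tgt),
    T.map (homOfLE h) ≫ b.hom = a.hom ≫ W.map (homOfLE h')
  le_refl a := ⟨le_rfl, le_rfl, by simp⟩
  le_trans a b c := by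
    rintro ⟨h₁, h₁', e₁⟩ ⟨h₂, h₂', e₂⟩
    refine ⟨h₁.trans h₂, h₁'.trans h₂', ?_⟩
    rw [← homOfLE_comp h₁ h₂, ← homOfLE_comp h₁' h₂', T.map_comp, W.map_comp, Category.assoc, e₂,
      reassoc_of% e₁]
  le_antisymm := by
    rintro ⟨s, t, a, _⟩ ⟨s', t', a', _⟩ ⟨h₁, h₁', e₁⟩ ⟨h₂, h₂', e₂⟩
    obtain rfl : s = s' := le_antisymm h₁ h₂
    obtain rfl : t = t' := le_antisymm h₁' h₂'
    obtain rfl : a' = a := by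
      simpa [show ∀ {j : J}, homOfLE (le_refl j) = 𝟙 j from rfl,
        show ∀ {j : J'}, homOfLE (le_refl j) = 𝟙 j from rfl] using e₁
    rfl

variable (c d f)

/-- The first projection. -/
def srcFunctor : LiftIndex c d f ⥤ J :=
  Monotone.functor (f := src) fun _ _ h => h.1

/-- The second projection. -/
def tgtFunctor : LiftIndex c d f ⥤ J' :=
  Monotone.functor (f := tgt) fun _ _ h => h.2.1

/-- The tautological natural transformation. -/
@[simps]
def natTrans : srcFunctor c d f ⋙ T ⟶ tgtFunctor c d f ⋙ W where
  app k := k.hom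
  naturality _ _ φ := (leOfHom φ).2.2

variable {κ : Cardinal.{w}} [Fact κ.IsRegular] [IsCardinalFiltered J κ] [IsCardinalFiltered J' κ]

variable {c d f} in
-- Any lift from a stage above all the sources is compatible with each `s k` after composing to
-- `d.pt`, hence already at some stage, as the source is presentable. Fewer than `κ` such stages
-- have a common bound. The bounds `j` and `j'` serve finality of the projections, where the family
-- is empty.
theorem exists_ge [∀ j, IsCardinalPresentable (T.obj j) κ] (hd : IsColimit d)
    {K : Type w} (s : K → LiftIndex c d f) (hK : HasCardinalLT K κ) (j : J) (j' : J') :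
    ∃ b : LiftIndex c d f, (∀ k, s k ≤ b) ∧ j ≤ b.src ∧ j' ≤ b.tgt := by
  have := isFiltered_of_isCardinalFiltered J κ
  have := isFiltered_of_isCardinalFiltered J' κ
  obtain ⟨m, hm, hjm⟩ : ∃ m, (∀ k, (s k).src ≤ m) ∧ j ≤ m :=
    ⟨IsFiltered.max (IsCardinalFiltered.max (fun k => (s k).src) hK) j,
      fun k => leOfHom (IsCardinalFiltered.toMax (fun k => (s k).src) hK k ≫
        IsFiltered.leftToMax _ _), leOfHom (IsFiltered.rightToMax _ _)⟩
  obtain ⟨n₀, g, hg⟩ := IsCardinalPresentable.exists_hom_of_isColimit κ hd (c.ι.app m ≫ f)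
  obtain ⟨n, hn, hn₀, hjn⟩ : ∃ n, (∀ k, (s k).tgt ≤ n) ∧ n₀ ≤ n ∧ j' ≤ n :=
    ⟨IsFiltered.max (IsCardinalFiltered.max (fun k => (s k).tgt) hK) (IsFiltered.max n₀ j'),
      fun k => leOfHom (IsCardinalFiltered.toMax (fun k => (s k).tgt) hK k ≫
        IsFiltered.leftToMax _ _),
      leOfHom (IsFiltered.leftToMax n₀ j' ≫ IsFiltered.rightToMax _ _),
      leOfHom (IsFiltered.rightToMax n₀ j' ≫ IsFiltered.rightToMax _ _)⟩
  have (k : K) : ∃ (p : J') (h : n ≤ p), (T.map (homOfLE (hm k)) ≫ g ≫ W.map (homOfLE hn₀)) ≫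
      W.map (homOfLE h) = ((s k).hom ≫ W.map (homOfLE (hn k))) ≫ W.map (homOfLE h) := by
    obtain ⟨p, u, hu⟩ := IsCardinalPresentable.exists_eq_of_isColimit' κ hd
      (T.map (homOfLE (hm k)) ≫ g ≫ W.map (homOfLE hn₀)) ((s k).hom ≫ W.map (homOfLE (hn k)))
      (by simp [hg, (s k).w])
    exact ⟨p, leOfHom u, hu⟩
  choose p hp e using this
  obtain ⟨q, hq, hnq⟩ : ∃ q, (∀ k, p k ≤ q) ∧ n ≤ q :=
    ⟨IsFiltered.max (IsCardinalFiltered.max p hK) n,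
      fun k => leOfHom (IsCardinalFiltered.toMax p hK k ≫
        IsFiltered.leftToMax _ _), leOfHom (IsFiltered.rightToMax _ _)⟩
  refine ⟨⟨m, q, g ≫ W.map (homOfLE (hn₀.trans hnq)), by simp [hg]⟩,
    fun k => ⟨hm k, (hn k).trans hnq, ?_⟩, hjm, hjn.trans hnq⟩
  have := e k =≫ W.map (homOfLE (hq k))
  simpa [← Functor.map_comp, homOfLE_comp] using this

theorem isCardinalFiltered [∀ j, IsCardinalPresentable (T.obj j) κ] (hd : IsColimit d) :
    IsCardinalFiltered (LiftIndex c d f) κ :=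
  isCardinalFiltered_preorder _ _ fun K s hK => by
    obtain ⟨b, hb, _⟩ := exists_ge hd s ((hasCardinalLT_iff_cardinal_mk_lt _ _).2 hK)
      (IsCardinalFiltered.nonempty J κ).some (IsCardinalFiltered.nonempty J' κ).some
    exact ⟨b, hb⟩

theorem final_srcFunctor [∀ j, IsCardinalPresentable (T.obj j) κ] (hd : IsColimit d) :
    (srcFunctor c d f).Final := by
  have := isCardinalFiltered c d f (κ := κ) hd
  have := isFiltered_of_isCardinalFiltered (LiftIndex c d f) κ
  refine Functor.final_of_exists_of_isFiltered _ (fun j => ?_)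
    (fun {_ k} _ _ => ⟨k, 𝟙 _, Subsingleton.elim _ _⟩)
  obtain ⟨b, -, hb, -⟩ := exists_ge hd (K := PEmpty) (f := f) (fun k => k.elim)
    (hasCardinalLT_of_finite _ _ (Cardinal.IsRegular.aleph0_le (Fact.out : κ.IsRegular))) j
    (IsCardinalFiltered.nonempty J' κ).some
  exact ⟨b, ⟨homOfLE hb⟩⟩

theorem final_tgtFunctor [∀ j, IsCardinalPresentable (T.obj j) κ] (hd : IsColimit d) :
    (tgtFunctor c d f).Final := by
  have := isCardinalFiltered c d f (κ := κ) hd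
  have := isFiltered_of_isCardinalFiltered (LiftIndex c d f) κ
  refine Functor.final_of_exists_of_isFiltered _ (fun j => ?_)
    (fun {_ k} _ _ => ⟨k, 𝟙 _, Subsingleton.elim _ _⟩)
  obtain ⟨b, -, -, hb⟩ := exists_ge hd (K := PEmpty) (f := f) (fun k => k.elim)
    (hasCardinalLT_of_finite _ _ (Cardinal.IsRegular.aleph0_le (Fact.out : κ.IsRegular)))
    (IsCardinalFiltered.nonempty J κ).some j
  exact ⟨b, ⟨homOfLE hb⟩⟩

end LiftIndex

/-- A cocone in the category of arrows is a colimit if both of its components are. -/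
theorem nonempty_isColimit_arrow {J : Type w} [SmallCategory J] {F : J ⥤ Arrow A} {c : Cocone F}
    (hl : IsColimit (Arrow.leftFunc.mapCocone c)) (hr : IsColimit (Arrow.rightFunc.mapCocone c)) :
    Nonempty (IsColimit c) :=
  ⟨Comma.fstSndJointlyReflectColimit (L := 𝟭 A) (R := 𝟭 A) (F := F) (c := c) hl hr⟩

/-- The functor to the category of arrows given by a natural transformation. -/
@[simps]
def arrowFunctor {J : Type w} [SmallCategory J] {F G : J ⥤ A} (α : F ⟶ G) : J ⥤ Arrow A where
  obj j := Arrow.mk (α.app j)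
  map φ := Arrow.homMk (F.map φ) (G.map φ)

/-- In a `κ`-accessible category, every morphism is a `κ`-directed colimit of morphisms between
`κ`-presentable objects. -/
theorem exists_colimitOfShape_arrow (κ : Cardinal.{w}) [Fact κ.IsRegular]
    [IsCardinalAccessibleCategory A κ] (f : Arrow A) :
    ∃ (J : Type w) (_ : PartialOrder J) (_ : IsCardinalFiltered J κ),
      Nonempty (ObjectProperty.ColimitOfShape (C := Arrow A)
        (fun g => IsCardinalPresentable g.left κ ∧ IsCardinalPresentable g.right κ) J f) := by
  obtain ⟨J, _, _, ⟨p⟩⟩ := exists_colimitOfShape_presentable (κ := κ) f.left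
  obtain ⟨J', _, _, ⟨p'⟩⟩ := exists_colimitOfShape_presentable (κ := κ) f.right
  have (j : J) : IsCardinalPresentable (p.diag.obj j) κ := p.prop_diag_obj j
  let c := Cocone.mk _ p.ι
  let d := Cocone.mk _ p'.ι
  let f' : c.pt ⟶ d.pt := f.hom
  have := LiftIndex.isCardinalFiltered (κ := κ) c d f' p'.isColimit
  have := LiftIndex.final_srcFunctor (κ := κ) c d f' p'.isColimit
  have := LiftIndex.final_tgtFunctor (κ := κ) c d f' p'.isColimit
  let e : Cocone (arrowFunctor (LiftIndex.natTrans c d f')) :=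
    { pt := f
      ι :=
        { app k := Arrow.homMk (p.ι.app k.src) (p'.ι.app k.tgt) k.w.symm
          naturality k l φ := by
            ext
            · exact p.ι.naturality _
            · exact p'.ι.naturality _ } }
  -- Each component of `e` is one of the given presentations restricted along a final projection.
  obtain ⟨he⟩ : Nonempty (IsColimit e) := nonempty_isColimit_arrow
    ((Functor.Final.isColimitWhiskerEquiv (LiftIndex.srcFunctor c d f') c).symm p.isColimit)
    ((Functor.Final.isColimitWhiskerEquiv (LiftIndex.tgtFunctor c d f') d).symm p'.isColimit)
  exact ⟨_, inferInstance, inferInstance, ⟨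
    { diag := _
      ι := e.ι
      isColimit := he
      prop_diag_obj k := ⟨p.prop_diag_obj _, p'.prop_diag_obj _⟩ }⟩⟩

end

/-! ### The factorization criterion -/

section

variable {A : Type u} [Category.{w} A] {κ : Cardinal.{w}} [Fact κ.IsRegular]

/-- Let `X` be a `κ`-filtered colimit of `κ`-presentable objects `D j`. If all the morphisms
`D j ⟶ X` factor through `κ`-presentable objects from `T`, then `X` is a `κ`-directed colimit of
objects from `T`. -/
theorem kDirectedColimits_of_factorization {T : ObjectProperty A}
    (hT : T ≤ isCardinalPresentable A κ) {J : Type w} [SmallCategory J] [IsCardinalFiltered J κ]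
    {D : J ⥤ A} [∀ j, IsCardinalPresentable (D.obj j) κ] {c : Cocone D} (hc : IsColimit c)
    (h : ∀ j, ∃ (q : A) (_ : T q) (a : D.obj j ⟶ q) (b : q ⟶ c.pt), a ≫ b = c.ι.app j) :
    kDirectedColimits κ T c.pt := by
  have := isFiltered_of_isCardinalFiltered J κ
  choose q hq a b hab using h
  have (j : J) : IsCardinalPresentable (q j) κ := hT _ (hq j)
  have hu (j : J) : ∃ (m : J) (u : q j ⟶ D.obj m), u ≫ c.ι.app m = b j :=
    IsCardinalPresentable.exists_hom_of_isColimit κ hc (b j)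
  choose m u hu using hu
  -- The new index has the objects of `J`, which keeps it small, but its morphisms are all morphisms
  -- `q j ⟶ q k` over the colimit.
  let K := InducedCategory (Over c.pt) (fun j => Over.mk (b j))
  let mkHom {j k : K} (g : q j ⟶ q k) (hg : g ≫ b k = b j) : j ⟶ k :=
    InducedCategory.homMk (Over.homMk g hg)
  have hom_w {j k : K} (g : j ⟶ k) : g.hom.left ≫ b k = b j := Over.w g.hom
  let G : K ⥤ A := inducedFunctor _ ⋙ Over.forget c.pt
  have hK : IsCardinalFiltered K κ := by
    rw [isCardinalFiltered_iff]
    refine ⟨fun ι s hι => ?_, fun ι j k f hι => ?_⟩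
    · let n := IsCardinalFiltered.max (fun i => m (s i)) hι
      -- Objects `q` map to one another by passing through `D`: lift into `D`, move to a common
      -- stage, return by `a n`.
      exact ⟨n, fun i => ⟨mkHom (u (s i) ≫
        D.map (IsCardinalFiltered.toMax (fun i => m (s i)) hι i) ≫ a n)
        (by rw [← hu (s i), Category.assoc, Category.assoc, hab, c.w])⟩⟩
    · let n : J := IsFiltered.max (m k) (m j)
      let v : m k ⟶ n := IsFiltered.leftToMax _ _
      let v' : m j ⟶ n := IsFiltered.rightToMax _ _
      let g (i : ι) : q j ⟶ q k := (f i).hom.left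
      have hg (i : ι) : g i ≫ b k = b j := hom_w (f i)
      -- Every `g i` becomes equal to one and the same map once pushed far enough into `D`; a wide
      -- span then gives a stage valid for all `i`.
      choose l x hx using fun i => IsCardinalPresentable.exists_eq_of_isColimit' κ hc
        (g i ≫ u k ≫ D.map v) (u j ≫ D.map v') (by simp [hu, hg])
      obtain ⟨p, y, z, hyz⟩ := IsCardinalFiltered.wideSpan x hι
      refine ⟨p, mkHom (u k ≫ D.map (v ≫ z) ≫ a p) (by simp [hab, hu]),
        mkHom (u j ≫ D.map (v' ≫ z) ≫ a p) (by simp [hab, hu]), fun i => ?_⟩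
      ext
      have := hx i =≫ (D.map (y i) ≫ a p)
      simp only [Category.assoc, ← D.map_comp_assoc, hyz] at this
      change g i ≫ (u k ≫ D.map (v ≫ z) ≫ a p) = u j ≫ D.map (v' ≫ z) ≫ a p
      simpa using this
  let cG : Cocone G :=
    { pt := c.pt
      ι := { app j := b j
             naturality j k g := by simpa [G] using hom_w g } }
  have hcG : IsColimit cG := by
    let σ (s : Cocone G) (j : J) : q j ⟶ s.pt := s.ι.app j
    have σ_w (s : Cocone G) {j k : J} (g : q j ⟶ q k) (hg : g ≫ b k = b j) : g ≫ σ s k = σ s j :=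
      s.w (mkHom g hg)
    -- Two maps from a presentable object that agree in the colimit agree at a stage `D l`, hence in
    -- `q l`, hence in every cocone on `G`. So cocones on `G` induce cocones on `D`.
    have key (s : Cocone G) {S : A} [IsCardinalPresentable S κ] {j k : J} (x : S ⟶ q j)
        (y : S ⟶ q k) (hxy : x ≫ b j = y ≫ b k) : x ≫ σ s j = y ≫ σ s k := by
      obtain ⟨l, v, v', e⟩ := IsCardinalPresentable.exists_eq_of_isColimit κ hc
        (x ≫ u j) (y ≫ u k) (by simpa [hu] using hxy)
      rw [← σ_w s (u j ≫ D.map v ≫ a l) (by simp [hab, hu]),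
        ← σ_w s (u k ≫ D.map v' ≫ a l) (by simp [hab, hu])]
      simpa using e =≫ (a l ≫ σ s l)
    let t (s : Cocone G) : Cocone D :=
      { pt := s.pt
        ι := { app j := a j ≫ σ s j
               naturality i j φ := by
                 simpa using key s (D.map φ ≫ a j) (a i) (by simp [hab]) } }
    refine
      { desc s := hc.desc (t s)
        fac s j := ?_
        uniq s g hg := ?_ }
    · change b j ≫ _ = σ s j
      rw [← hu j, Category.assoc, hc.fac]
      simpa [t] using key s (u j ≫ a _) (𝟙 (q j)) (by simp [hab, hu])
    · refine hc.hom_ext fun j => ?_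
      rw [hc.fac, ← hab, Category.assoc]
      exact congr_arg (a j ≫ ·) (hg j)
  obtain ⟨α, _, _, F, _⟩ := IsCardinalFiltered.exists_cardinal_directed K κ
  exact ⟨α, inferInstance, inferInstance, ObjectProperty.colimitsOfShape_le_of_final _ F _
    ⟨{ diag := G, ι := cG.ι, isColimit := hcG, prop_diag_obj := hq }⟩⟩

theorem ambientClass.presentable_left
    {Q : MorphismProperty (isCardinalPresentable A κ).FullSubcategory}
    {X Y : A} {f : X ⟶ Y} (h : ambientClass Q f) : IsCardinalPresentable X κ := h.choose

theorem ambientClass.presentable_right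
    {Q : MorphismProperty (isCardinalPresentable A κ).FullSubcategory}
    {X Y : A} {f : X ⟶ Y} (h : ambientClass Q f) : IsCardinalPresentable Y κ :=
  h.choose_spec.choose

variable [IsCardinalAccessibleCategory A κ]

/-- A morphism is a `κ`-directed colimit of morphisms from `Q` if and only if every morphism to it
from a morphism between `κ`-presentable objects factors through a morphism from `Q`. -/
theorem directedColimitClass_iff
    (Q : MorphismProperty (isCardinalPresentable A κ).FullSubcategory) {X Y : A} (f : X ⟶ Y) :
    directedColimitClass κ Q f ↔ ∀ {S T : A} [IsCardinalPresentable S κ]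
      [IsCardinalPresentable T κ] (g : S ⟶ T) (a : S ⟶ X) (b : T ⟶ Y), a ≫ f = g ≫ b →
      ∃ (U W : A) (q : U ⟶ W) (_ : ambientClass Q q) (a₁ : S ⟶ U) (a₂ : U ⟶ X) (b₁ : T ⟶ W)
        (b₂ : W ⟶ Y), a₁ ≫ a₂ = a ∧ b₁ ≫ b₂ = b ∧ a₁ ≫ q = g ≫ b₁ ∧ a₂ ≫ f = q ≫ b₂ := by
  constructor
  · rintro ⟨J, _, _, ⟨p⟩⟩ S T _ _ g a b h
    have : IsCardinalPresentable (Arrow.mk g).left κ := ‹IsCardinalPresentable S κ›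
    have : IsCardinalPresentable (Arrow.mk g).right κ := ‹IsCardinalPresentable T κ›
    have := isCardinalPresentable_arrow (κ := κ) (Arrow.mk g)
    obtain ⟨j, φ, hφ⟩ := IsCardinalPresentable.exists_hom_of_isColimit κ p.isColimit
      (Arrow.homMk a b h : Arrow.mk g ⟶ Arrow.mk f)
    exact ⟨_, _, _, p.prop_diag_obj j, φ.left, (p.ι.app j).left, φ.right, (p.ι.app j).right,
      Arrow.hom.congr_left hφ, Arrow.hom.congr_right hφ, Arrow.w φ, Arrow.w (p.ι.app j)⟩
  · intro h
    obtain ⟨J, _, _, ⟨p⟩⟩ := exists_colimitOfShape_arrow κ (Arrow.mk f)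
    have (j : J) : IsCardinalPresentable (p.diag.obj j).left κ := (p.prop_diag_obj j).1
    have (j : J) : IsCardinalPresentable (p.diag.obj j).right κ := (p.prop_diag_obj j).2
    have (j : J) : IsCardinalPresentable (p.diag.obj j) κ := isCardinalPresentable_arrow _
    refine kDirectedColimits_of_factorization (T := arrowClass (ambientClass Q)) ?_ p.isColimit
      fun j => ?_
    · intro q hq
      have := ambientClass.presentable_left hq
      have := ambientClass.presentable_right hq
      exact isCardinalPresentable_arrow q
    · obtain ⟨U, W, q, hq, a₁, a₂, b₁, b₂, h₁, h₂, h₃, h₄⟩ := h (p.diag.obj j).hom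
        (p.ι.app j).left (p.ι.app j).right (Arrow.w (p.ι.app j))
      exact ⟨Arrow.mk q, hq, Arrow.homMk a₁ b₁ h₃, Arrow.homMk a₂ b₂ h₄, Arrow.hom_ext _ _ h₁ h₂⟩

end

/-! ### Closure properties of the class -/

section

variable {A : Type u} [Category.{w} A] {κ : Cardinal.{w}} [Fact κ.IsRegular]
  [IsCardinalAccessibleCategory A κ]
  {Q : MorphismProperty (isCardinalPresentable A κ).FullSubcategory}

/-- Pullbacks in the full subcategory of `κ`-presentable objects are pullbacks in the ambient
`κ`-accessible category. -/
theorem isPullback_of_fullSubcategory {P X Y Z : (isCardinalPresentable A κ).FullSubcategory}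
    {fst : P ⟶ X} {snd : P ⟶ Y} {f : X ⟶ Z} {g : Y ⟶ Z} (h : IsPullback fst snd f g) :
    IsPullback fst.hom snd.hom f.hom g.hom := by
  refine isPullback_of_presentable κ (congr_arg (·.hom) h.w) (fun S hS a b hab => ?_)
    (fun S hS l l' h₁ h₂ => ?_)
  · let S' : (isCardinalPresentable A κ).FullSubcategory := ⟨S, hS⟩
    let a' : S' ⟶ X := ObjectProperty.homMk a
    let b' : S' ⟶ Y := ObjectProperty.homMk b
    have e : a' ≫ f = b' ≫ g := by ext; exact hab
    exact ⟨(h.lift a' b' e).hom, congr_arg (·.hom) (h.lift_fst a' b' e),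
      congr_arg (·.hom) (h.lift_snd a' b' e)⟩
  · let S' : (isCardinalPresentable A κ).FullSubcategory := ⟨S, hS⟩
    have e : (ObjectProperty.homMk l : S' ⟶ P) = ObjectProperty.homMk l' :=
      h.hom_ext (by ext; exact h₁) (by ext; exact h₂)
    exact congr_arg (·.hom) e

theorem ambientClass.exists_isPullback (hQ : IsQEEpiClass Q) {U W T : A} {q : U ⟶ W}
    (hq : ambientClass Q q) (t : T ⟶ W) [hT : IsCardinalPresentable T κ] :
    ∃ (R : A) (r₁ : R ⟶ U) (r₂ : R ⟶ T), IsPullback r₁ r₂ q t ∧ ambientClass Q r₂ := by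
  obtain ⟨hU, hW, hq⟩ := hq
  let T' : (isCardinalPresentable A κ).FullSubcategory := ⟨T, hT⟩
  let W' : (isCardinalPresentable A κ).FullSubcategory := ⟨W, hW⟩
  let t' : T' ⟶ W' := ObjectProperty.homMk t
  have := hQ.hasPullback _ t' hq
  have sq := IsPullback.of_hasPullback (ObjectProperty.homMk q : ⟨U, hU⟩ ⟶ W') t'
  exact ⟨_, _, _, isPullback_of_fullSubcategory sq, ObjectProperty.FullSubcategory.property _,
    T'.property, hQ.of_isPullback sq hq⟩

theorem ambientClass.hasPullback (hQ : IsQEEpiClass Q) {U W T : A} {q : U ⟶ W}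
    (hq : ambientClass Q q) (t : T ⟶ W) [IsCardinalPresentable T κ] : HasPullback q t := by
  obtain ⟨_, _, _, sq, _⟩ := hq.exists_isPullback hQ t
  exact sq.hasPullback

theorem ambientClass.presentable_of_isPullback (hQ : IsQEEpiClass Q) {R U W T : A} {q : U ⟶ W}
    (hq : ambientClass Q q) {t : T ⟶ W} [IsCardinalPresentable T κ] {r₁ : R ⟶ U} {r₂ : R ⟶ T}
    (sq : IsPullback r₁ r₂ q t) : IsCardinalPresentable R κ := by
  obtain ⟨R', _, r₂', sq', h⟩ := hq.exists_isPullback hQ t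
  have := h.presentable_left
  exact isCardinalPresentable_of_iso (sq'.isoIsPullback _ _ sq) κ

theorem ambientClass.directedColimitClass {U W : A} {q : U ⟶ W} (hq : ambientClass Q q) :
    directedColimitClass κ Q q :=
  (directedColimitClass_iff Q q).2 fun {S T} _ _ g a b h =>
    ⟨U, W, q, hq, a, 𝟙 _, b, 𝟙 _, by simp, by simp, h, by simp⟩

theorem directedColimitClass_id (hQ : IsQEEpiClass Q) (X : A) :
    directedColimitClass κ Q (𝟙 X) :=
  (directedColimitClass_iff Q _).2 fun {S T} hS hT g a b h =>
    ⟨T, T, 𝟙 T, ⟨hT, hT, hQ.id_mem _⟩, g, b, 𝟙 _, b, by simpa using h.symm, by simp, by simp,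
      by simp⟩

/-- Factoring the square first over `g` and then over `f` gives morphisms from `Q` that need not be
composable. Pulling the second back along `d₁` makes them so, and its target becomes the source of
the first. -/
theorem directedColimitClass_comp (hQ : IsQEEpiClass Q) {X Y Z : A} {f : X ⟶ Y} {g : Y ⟶ Z}
    (hf : directedColimitClass κ Q f) (hg : directedColimitClass κ Q g) :
    directedColimitClass κ Q (f ≫ g) := by
  rw [directedColimitClass_iff] at hf hg ⊢
  intro S T _ _ s a b h
  obtain ⟨V, W, q, hq, a₁, a₂, b₁, b₂, rfl', rfl, e₁, e₂⟩ := hg s (a ≫ f) b (by simpa using h)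
  have := hq.presentable_left
  obtain ⟨U, V', q', hq', c₁, c₂, d₁, d₂, rfl, rfl, e₃, e₄⟩ := hf a₁ a a₂ rfl'.symm
  obtain ⟨R, r₁, r₂, sq, ⟨_, _, hr⟩⟩ := hq'.exists_isPullback hQ d₁
  refine ⟨R, W, r₂ ≫ q, ⟨‹_›, hq.presentable_right, ?_⟩, sq.lift c₁ a₁ e₃, r₁ ≫ c₂, b₁, b₂,
    by simp, rfl, by simpa using e₁, ?_⟩
  · exact hQ.comp_mem _ _ hr hq.choose_spec.choose_spec
  · simp only [Category.assoc] at e₂ ⊢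
    simp [reassoc_of% e₄, reassoc_of% sq.w, e₂]

/-- The square into `f` factors through some `q` from `Q`; the base change of `q` to `T` provides
the factorization over `f'`. -/
theorem directedColimitClass_of_isPullback (hQ : IsQEEpiClass Q) {X Y X' Y' : A} {f : X ⟶ Y}
    {g : Y' ⟶ Y} {g' : X' ⟶ X} {f' : X' ⟶ Y'} (sq : IsPullback g' f' f g)
    (hf : directedColimitClass κ Q f) : directedColimitClass κ Q f' := by
  rw [directedColimitClass_iff] at hf ⊢
  intro S T _ _ s a b h
  obtain ⟨U, W, q, hq, a₁, a₂, b₁, b₂, h₁, h₂, e₁, e₂⟩ := hf s (a ≫ g') (b ≫ g)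
    (by simp [sq.w, reassoc_of% h])
  obtain ⟨R, r₁, r₂, sq', hr⟩ := hq.exists_isPullback hQ b₁
  have e : (r₁ ≫ a₂) ≫ f = (r₂ ≫ b) ≫ g := by simp [e₂, reassoc_of% sq'.w, h₂]
  exact ⟨R, T, r₂, hr, sq'.lift a₁ s e₁, sq.lift _ _ e, 𝟙 _, b,
    sq.hom_ext (by simp [h₁]) (by simp [h]), by simp, by simp, by simp⟩

/-- The class of `κ`-directed colimits of morphisms from `Q` is closed under `κ`-directed
colimits. -/
theorem directedColimitClass_of_isColimit {J : Type w} [SmallCategory J] [IsCardinalFiltered J κ]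
    {F G : J ⥤ A} {α : F ⟶ G} (hα : ∀ j, directedColimitClass κ Q (α.app j))
    {c : Cocone F} {d : Cocone G} (hc : IsColimit c) (hd : IsColimit d) {f : c.pt ⟶ d.pt}
    (hf : ∀ j, c.ι.app j ≫ f = α.app j ≫ d.ι.app j) : directedColimitClass κ Q f := by
  have := isFiltered_of_isCardinalFiltered J κ
  rw [directedColimitClass_iff]
  intro S T _ _ s a b h
  obtain ⟨i, a, rfl⟩ := IsCardinalPresentable.exists_hom_of_isColimit κ hc a
  obtain ⟨i', b, rfl⟩ := IsCardinalPresentable.exists_hom_of_isColimit κ hd b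
  obtain ⟨k, u, v, huv⟩ := IsCardinalPresentable.exists_eq_of_isColimit κ hd
    (a ≫ α.app i) (s ≫ b) (by simpa [hf] using h)
  obtain ⟨U, W, q, hq, a₁, a₂, b₁, b₂, h₁, h₂, e₁, e₂⟩ := (directedColimitClass_iff Q _).1 (hα k)
    s (a ≫ F.map u) (b ≫ G.map v) (by simpa using huv)
  exact ⟨U, W, q, hq, a₁, a₂ ≫ c.ι.app k, b₁, b₂ ≫ d.ι.app k, by simp [reassoc_of% h₁],
    by simp [reassoc_of% h₂], e₁, by simp [hf, reassoc_of% e₂]⟩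

/-- The criterion applied to the identity square of `p` exhibits `p` as a retract of some `q` from
`Q`. Then `D'` is a retract of a pullback of `q`, which is presentable. -/
theorem directedColimitClass_presentable_of_isPullback (hQ : IsQEEpiClass Q) {D E D' E' : A}
    {p : D ⟶ E} {f : E' ⟶ E} {f' : D' ⟶ D} {p' : D' ⟶ E'} (sq : IsPullback f' p' p f)
    (hp : directedColimitClass κ Q p) [IsCardinalPresentable D κ] [IsCardinalPresentable E κ]
    [IsCardinalPresentable E' κ] : IsCardinalPresentable D' κ := by
  obtain ⟨U, W, q, hq, a₁, a₂, b₁, b₂, h₁, h₂, e₁, e₂⟩ :=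
    (directedColimitClass_iff Q p).1 hp p (𝟙 _) (𝟙 _) (by simp)
  obtain ⟨R, r₁, r₂, sq', hr⟩ := hq.exists_isPullback hQ (f ≫ b₁)
  have := hr.presentable_left
  let ρ : Retract D' R :=
    { i := sq'.lift (f' ≫ a₁) p' (by simp [e₁, reassoc_of% sq.w])
      r := sq.lift (r₁ ≫ a₂) r₂ (by simp [e₂, reassoc_of% sq'.w, h₂])
      retract := sq.hom_ext (by simp [h₁]) (by simp) }
  exact ρ.isCardinalPresentable κ

end

/-! ### Objectwise pullbacks and their colimits -/

section

variable {A : Type u} [Category.{w} A] {J : Type w} [SmallCategory J] {X Y Z : J ⥤ A}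
  (f : X ⟶ Z) (g : Y ⟶ Z) [∀ j, HasPullback (f.app j) (g.app j)]

/-- The objectwise pullback of functors. -/
@[simps]
noncomputable def pullbackFunctor : J ⥤ A where
  obj j := pullback (f.app j) (g.app j)
  map φ := pullback.lift (pullback.fst _ _ ≫ X.map φ) (pullback.snd _ _ ≫ Y.map φ)
    (by simp [pullback.condition_assoc])
  map_id _ := by apply pullback.hom_ext <;> simp
  map_comp φ ψ := by
    apply pullback.hom_ext
    · simp [pullback.lift_fst, pullback.lift_fst_assoc]
    · simp [pullback.lift_snd, pullback.lift_snd_assoc]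

/-- The first projection. -/
@[simps]
noncomputable def pullbackFunctorFst : pullbackFunctor f g ⟶ X where
  app _ := pullback.fst _ _
  naturality _ _ _ := pullback.lift_fst _ _ _

/-- The second projection. -/
@[simps]
noncomputable def pullbackFunctorSnd : pullbackFunctor f g ⟶ Y where
  app _ := pullback.snd _ _
  naturality _ _ _ := pullback.lift_snd _ _ _

theorem isPullback_pullbackFunctor_app (j : J) :
    IsPullback ((pullbackFunctorFst f g).app j) ((pullbackFunctorSnd f g).app j) (f.app j)
      (g.app j) :=
  IsPullback.of_hasPullback _ _

variable {f g}

theorem hasPullback_of_isColimit (κ : Cardinal.{w}) [Fact κ.IsRegular]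
    [IsCardinalAccessibleCategory A κ] [IsCardinalFiltered J κ]
    {cX : Cocone X} {cY : Cocone Y} {cZ : Cocone Z}
    (hX : IsColimit cX) (hY : IsColimit cY) (hZ : IsColimit cZ)
    {f' : cX.pt ⟶ cZ.pt} {g' : cY.pt ⟶ cZ.pt}
    (hf : ∀ j, cX.ι.app j ≫ f' = f.app j ≫ cZ.ι.app j)
    (hg : ∀ j, cY.ι.app j ≫ g' = g.app j ≫ cZ.ι.app j) : HasPullback f' g' := by
  have := HasCardinalFilteredColimits.hasColimitsOfShape (κ := κ) A J
  have hP := colimit.isColimit (pullbackFunctor f g)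
  exact (isPullback_of_isColimit κ (isPullback_pullbackFunctor_app f g) hP hX hY hZ
    (fst' := hP.desc ((Cocone.precompose (pullbackFunctorFst f g)).obj cX))
    (snd' := hP.desc ((Cocone.precompose (pullbackFunctorSnd f g)).obj cY))
    (fun j => hP.fac _ j) (fun j => hP.fac _ j) hf hg).hasPullback

/-- In a `κ`-accessible category, the pullback of `κ`-filtered colimits is the colimit of the
pullbacks. -/
theorem nonempty_isColimit_of_isPullback (κ : Cardinal.{w}) [Fact κ.IsRegular]
    [IsCardinalAccessibleCategory A κ] [IsCardinalFiltered J κ]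
    {cP : Cocone (pullbackFunctor f g)} {cX : Cocone X}
    {cY : Cocone Y} {cZ : Cocone Z} (hX : IsColimit cX) (hY : IsColimit cY) (hZ : IsColimit cZ)
    {fst' : cP.pt ⟶ cX.pt} {snd' : cP.pt ⟶ cY.pt} {f' : cX.pt ⟶ cZ.pt} {g' : cY.pt ⟶ cZ.pt}
    (sq : IsPullback fst' snd' f' g')
    (hfst : ∀ j, cP.ι.app j ≫ fst' = pullback.fst (f.app j) (g.app j) ≫ cX.ι.app j)
    (hsnd : ∀ j, cP.ι.app j ≫ snd' = pullback.snd (f.app j) (g.app j) ≫ cY.ι.app j)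
    (hf : ∀ j, cX.ι.app j ≫ f' = f.app j ≫ cZ.ι.app j)
    (hg : ∀ j, cY.ι.app j ≫ g' = g.app j ≫ cZ.ι.app j) : Nonempty (IsColimit cP) := by
  have := HasCardinalFilteredColimits.hasColimitsOfShape (κ := κ) A J
  have hP := colimit.isColimit (pullbackFunctor f g)
  have sq' := isPullback_of_isColimit κ (isPullback_pullbackFunctor_app f g) hP hX hY hZ
    (fst' := hP.desc cP ≫ fst') (snd' := hP.desc cP ≫ snd')
    (fun j => by rw [hP.fac_assoc, hfst]; rfl) (fun j => by rw [hP.fac_assoc, hsnd]; rfl) hf hg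
  -- The colimit of the pullbacks and `cP.pt` are pullbacks of the same cospan, so the comparison
  -- map is invertible.
  have e : hP.desc cP = (sq'.isoIsPullback _ _ sq).hom := sq.hom_ext (by simp) (by simp)
  have : IsIso (hP.desc cP) := by rw [e]; infer_instance
  exact ⟨hP.ofPointIso⟩

end

/-! ### Existence of pullbacks -/

section

variable {A : Type u} [Category.{w} A] {κ : Cardinal.{w}} [Fact κ.IsRegular]
  [IsCardinalAccessibleCategory A κ]
  {Q : MorphismProperty (isCardinalPresentable A κ).FullSubcategory}

/-- A presentation of a morphism as a `κ`-directed colimit of morphisms from `Q`, in terms of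
the sources and the targets. -/
theorem directedColimitClass.exists_natTrans {D E : A} {p : D ⟶ E}
    (hp : directedColimitClass κ Q p) :
    ∃ (J : Type w) (_ : PartialOrder J) (_ : IsCardinalFiltered J κ) (F G : J ⥤ A) (α : F ⟶ G)
      (c : F ⟶ (Functor.const J).obj D) (d : G ⟶ (Functor.const J).obj E),
      Nonempty (IsColimit (Cocone.mk _ c)) ∧ Nonempty (IsColimit (Cocone.mk _ d)) ∧
      (∀ j, ambientClass Q (α.app j)) ∧ ∀ j, c.app j ≫ p = α.app j ≫ d.app j := by
  obtain ⟨J, _, _, ⟨h⟩⟩ := hp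
  have := HasCardinalFilteredColimits.hasColimitsOfShape (κ := κ) A J
  exact ⟨J, inferInstance, inferInstance, h.diag ⋙ Arrow.leftFunc, h.diag ⋙ Arrow.rightFunc,
    Functor.whiskerLeft h.diag Arrow.leftToRight,
    (Arrow.leftFunc.mapCocone (Cocone.mk _ h.ι)).ι, (Arrow.rightFunc.mapCocone (Cocone.mk _ h.ι)).ι,
    ⟨isColimitOfPreserves Arrow.leftFunc h.isColimit⟩,
    ⟨isColimitOfPreserves Arrow.rightFunc h.isColimit⟩,
    h.prop_diag_obj, fun j => Arrow.w (h.ι.app j)⟩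

/-- Over the poset of lifts of `f`, the cospan becomes a `κ`-directed colimit of cospans with one
leg from `Q` and presentable terms. These have pullbacks, whose colimit is the required one. -/
theorem directedColimitClass_hasPullback (hQ : IsQEEpiClass Q) {D E E' : A} (p : D ⟶ E)
    (f : E' ⟶ E) (hp : directedColimitClass κ Q p) : HasPullback p f := by
  obtain ⟨J, _, _, F, G, α, c, d, ⟨hc⟩, ⟨hd⟩, hα, h⟩ := hp.exists_natTrans
  obtain ⟨J', _, _, ⟨t⟩⟩ := exists_colimitOfShape_presentable (κ := κ) E'
  have (j : J') : IsCardinalPresentable (t.diag.obj j) κ := t.prop_diag_obj j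
  let cT := Cocone.mk _ t.ι
  let cG := Cocone.mk _ d
  let f' : cT.pt ⟶ cG.pt := f
  have := LiftIndex.isCardinalFiltered (κ := κ) cT cG f' hd
  have := LiftIndex.final_srcFunctor (κ := κ) cT cG f' hd
  have := LiftIndex.final_tgtFunctor (κ := κ) cT cG f' hd
  let S := LiftIndex.srcFunctor cT cG f'
  let T := LiftIndex.tgtFunctor cT cG f'
  let φ : T ⋙ F ⟶ T ⋙ G := Functor.whiskerLeft T α
  let ψ : S ⋙ t.diag ⟶ T ⋙ G := LiftIndex.natTrans cT cG f'
  have (k : LiftIndex cT cG f') : HasPullback (φ.app k) (ψ.app k) :=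
    (hα k.tgt).hasPullback hQ (T := t.diag.obj k.src) k.hom
  exact hasPullback_of_isColimit κ (f := φ) (g := ψ)
    ((Functor.Final.isColimitWhiskerEquiv T _).symm hc)
    ((Functor.Final.isColimitWhiskerEquiv S _).symm t.isColimit)
    ((Functor.Final.isColimitWhiskerEquiv T _).symm hd) (fun k => h k.tgt) (fun k => k.w.symm)

end

/-! ### Coequalizers of kernel pairs -/

section

variable {A : Type u} [Category.{w} A] {κ : Cardinal.{w}} [Fact κ.IsRegular]
  [IsCardinalAccessibleCategory A κ]
  {Q : MorphismProperty (isCardinalPresentable A κ).FullSubcategory}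

/-- A parallel pair out of `W` lands in a presentable stage of its target, where it is already
equalized by `q`. There the coequalizer property in the subcategory applies. -/
theorem ambientClass.epi (hQ : IsQEEpiClass Q) {U W : A} {q : U ⟶ W} (hq : ambientClass Q q) :
    Epi q := by
  refine ⟨fun {Z} x y hxy => ?_⟩
  have := hq.presentable_left
  have := hq.presentable_right
  obtain ⟨hU, hW, hq⟩ := hq
  obtain ⟨J, _, _, ⟨z⟩⟩ := exists_colimitOfShape_presentable (κ := κ) Z
  obtain ⟨i, x, rfl⟩ := IsCardinalPresentable.exists_hom_of_isColimit κ z.isColimit x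
  obtain ⟨i', y, rfl⟩ := IsCardinalPresentable.exists_hom_of_isColimit κ z.isColimit y
  obtain ⟨k, u, v, huv⟩ := IsCardinalPresentable.exists_eq_of_isColimit κ z.isColimit
    (q ≫ x) (q ≫ y) (by simpa using hxy)
  have := hQ.hasPullback _ (ObjectProperty.homMk q : (⟨U, hU⟩ : ObjectProperty.FullSubcategory _) ⟶
    ⟨W, hW⟩) hq
  obtain ⟨hc⟩ := hQ.isCoequalizer hq (IsPullback.of_hasPullback _ _)
  have e : (ObjectProperty.homMk (x ≫ z.diag.map u) :
      (⟨W, hW⟩ : ObjectProperty.FullSubcategory _) ⟶ ⟨z.diag.obj k, z.prop_diag_obj k⟩) =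
      ObjectProperty.homMk (y ≫ z.diag.map v) :=
    Cofork.IsColimit.hom_ext hc (by ext; simpa using huv)
  simpa using congr_arg (·.hom) e =≫ z.ι.app k

/-- A morphism from `Q` is the coequalizer of its kernel pair in the ambient category. -/
theorem ambientClass.exists_desc (hQ : IsQEEpiClass Q) {U W Z : A} {q : U ⟶ W}
    (hq : ambientClass Q q) (h : U ⟶ Z)
    (w : ∀ {S : A} (x y : S ⟶ U), x ≫ q = y ≫ q → x ≫ h = y ≫ h) : ∃ l : W ⟶ Z, q ≫ l = h := by
  have := hq.presentable_left
  have := hq.presentable_right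
  obtain ⟨hU, hW, hq⟩ := hq
  let q' : (⟨U, hU⟩ : ObjectProperty.FullSubcategory _) ⟶ ⟨W, hW⟩ := ObjectProperty.homMk q
  obtain ⟨J, _, _, ⟨z⟩⟩ := exists_colimitOfShape_presentable (κ := κ) Z
  obtain ⟨i, h, rfl⟩ := IsCardinalPresentable.exists_hom_of_isColimit κ z.isColimit h
  have := hQ.hasPullback _ q' hq
  have sq := IsPullback.of_hasPullback q' q'
  obtain ⟨hc⟩ := hQ.isCoequalizer hq sq
  -- The kernel pair is taken in the subcategory, so its object is presentable and the equality
  -- holds at a stage of `Z`.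
  obtain ⟨k, u, hu⟩ := IsCardinalPresentable.exists_eq_of_isColimit' κ z.isColimit
    ((pullback.fst q' q').hom ≫ h) ((pullback.snd q' q').hom ≫ h)
    (by simpa using w _ _ (congr_arg (·.hom) sq.w))
  obtain ⟨l, hl⟩ := Cofork.IsColimit.desc' hc (ObjectProperty.homMk (h ≫ z.diag.map u) :
      (⟨U, hU⟩ : ObjectProperty.FullSubcategory _) ⟶ ⟨z.diag.obj k, z.prop_diag_obj k⟩)
    (by ext; simpa using hu)
  have hl' : q ≫ l.hom = h ≫ z.diag.map u := congr_arg (·.hom) hl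
  exact ⟨l.hom ≫ z.ι.app k, by simp [reassoc_of% hl']⟩

/-- A pair identified by `α j` is identified by `p`, so it lifts to `K`. Hence a cofork descends
along each `α j`, and these descents glue because every `α j` is an epimorphism in `A`. -/
theorem directedColimitClass_isCoequalizer (hQ : IsQEEpiClass Q) {K D E : A} {p : D ⟶ E}
    {k₁ k₂ : K ⟶ D} (hp : directedColimitClass κ Q p) (hk : IsKernelPair p k₁ k₂) :
    Nonempty (IsColimit (Cofork.ofπ p hk.w)) := by
  obtain ⟨J, _, _, F, G, α, c, d, ⟨hc⟩, ⟨hd⟩, hα, h⟩ := hp.exists_natTrans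
  have (j : J) : Epi (α.app j) := (hα j).epi hQ
  have ex (s : Cofork k₁ k₂) : ∃ l : E ⟶ s.pt, p ≫ l = s.π := by
    have hj (j : J) : ∃ l : G.obj j ⟶ s.pt, α.app j ≫ l = c.app j ≫ s.π := by
      refine (hα j).exists_desc hQ _ fun {S} x y hxy => ?_
      have e : (x ≫ c.app j) ≫ p = (y ≫ c.app j) ≫ p := by
        simp [h, reassoc_of% hxy]
      have := hk.lift _ _ e ≫= s.condition
      rwa [← Category.assoc, ← Category.assoc, hk.lift_fst, hk.lift_snd, Category.assoc,
        Category.assoc] at this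
    choose l hl using hj
    let t : Cocone G :=
      { pt := s.pt
        ι := { app := l
               naturality i j φ := by
                 rw [← cancel_epi (α.app i), ← α.naturality_assoc, hl]
                 have := c.naturality φ
                 simp_all [reassoc_of% this] } }
    have ht (j : J) : d.app j ≫ hd.desc t = l j := hd.fac t j
    refine ⟨hd.desc t, hc.hom_ext fun j => ?_⟩
    change c.app j ≫ p ≫ hd.desc t = c.app j ≫ s.π
    rw [reassoc_of% (h j), ht, hl]
  have : Epi p := ⟨fun x y hxy => hd.hom_ext fun j => by
    change d.app j ≫ x = d.app j ≫ y
    rw [← cancel_epi (α.app j), ← reassoc_of% (h j), ← reassoc_of% (h j), hxy]⟩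
  exact ⟨Cofork.IsColimit.mk _ (fun s => (ex s).choose) (fun s => (ex s).choose_spec)
    fun s m hm => by rw [← cancel_epi p]; exact hm.trans (ex s).choose_spec.symm⟩

theorem isQEEpiClass_directedColimitClass (hQ : IsQEEpiClass Q) :
    IsQEEpiClass (directedColimitClass κ Q) where
  hasPullback := directedColimitClass_hasPullback hQ
  of_isPullback := directedColimitClass_of_isPullback hQ
  isCoequalizer := directedColimitClass_isCoequalizer hQ
  id_mem := directedColimitClass_id hQ
  comp_mem _ _ := directedColimitClass_comp hQ

end

/-! ### Diagrams of shape `K ⇉ D ⟶ E` -/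

section

variable {C : Type u} [Category.{v} C]

/-- The functor from the category `K ⇉ D ⟶ E` given by a diagram of this shape. -/
def WalkingSeq.lift {K D E : C} (k₁ k₂ : K ⟶ D) (p : D ⟶ E) (w : k₁ ≫ p = k₂ ≫ p) :
    WalkingSeq ⥤ C where
  obj
    | .K => K
    | .D => D
    | .E => E
  map
    | .id _ => 𝟙 _
    | .k₁ => k₁
    | .k₂ => k₂
    | .p => p
    | .kp => k₁ ≫ p
  map_id _ := rfl
  map_comp {X Y Z} (f : WalkingSeq.Hom X Y) (g : WalkingSeq.Hom Y Z) := by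
    cases f <;> cases g <;> first | exact (Category.id_comp _).symm |
      exact (Category.comp_id _).symm | rfl | exact w

/-- Natural transformations between functors from the category `K ⇉ D ⟶ E`. -/
def WalkingSeq.natTrans {F G : WalkingSeq ⥤ C} (a : F.obj .K ⟶ G.obj .K) (b : F.obj .D ⟶ G.obj .D)
    (c : F.obj .E ⟶ G.obj .E) (h₁ : F.map fst ≫ b = a ≫ G.map fst)
    (h₂ : F.map snd ≫ b = a ≫ G.map snd) (h₃ : F.map quo ≫ c = b ≫ G.map quo) : F ⟶ G where
  app
    | .K => a
    | .D => b
    | .E => c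
  naturality X Y (f : WalkingSeq.Hom X Y) := by
    cases f with
    | id X =>
      have (t : F.obj X ⟶ G.obj X) : F.map (𝟙 X) ≫ t = t ≫ G.map (𝟙 X) := by simp
      exact this _
    | k₁ => exact h₁
    | k₂ => exact h₂
    | p => exact h₃
    | kp =>
      change F.map (fst ≫ quo) ≫ c = a ≫ G.map (fst ≫ quo)
      rw [F.map_comp, G.map_comp, Category.assoc, h₃, reassoc_of% h₁]

end

/-! ### Sequences as directed colimits of presentable sequences -/

section

variable {A : Type u} [Category.{w} A] {κ : Cardinal.{w}} [Fact κ.IsRegular]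
  [IsCardinalAccessibleCategory A κ]
  {Q : MorphismProperty (isCardinalPresentable A κ).FullSubcategory}

/-- `κ`-directed colimits of sequences are sequences. -/
theorem isPSequence_of_kDirectedColimits {F : WalkingSeq ⥤ A}
    (hF : kDirectedColimits κ (IsPSequence (directedColimitClass κ Q)) F) :
    IsPSequence (directedColimitClass κ Q) F := by
  obtain ⟨J, _, _, ⟨h⟩⟩ := hF
  have := HasCardinalFilteredColimits.hasColimitsOfShape (κ := κ) A J
  have hK := isColimitOfPreserves ((evaluation _ _).obj WalkingSeq.K) h.isColimit
  have hD := isColimitOfPreserves ((evaluation _ _).obj WalkingSeq.D) h.isColimit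
  have hE := isColimitOfPreserves ((evaluation _ _).obj WalkingSeq.E) h.isColimit
  let τ {X Y : WalkingSeq} (f : X ⟶ Y) := Functor.whiskerLeft h.diag ((evaluation _ A).map f)
  have nat {X Y : WalkingSeq} (f : X ⟶ Y) (j : J) :
      (h.ι.app j).app X ≫ F.map f = (h.diag.obj j).map f ≫ (h.ι.app j).app Y :=
    ((h.ι.app j).naturality f).symm
  exact ⟨directedColimitClass_of_isColimit (α := τ WalkingSeq.quo)
      (fun j => (h.prop_diag_obj j).1) hD hE (nat _),
    isPullback_of_isColimit κ (fst := τ WalkingSeq.fst) (snd := τ WalkingSeq.snd)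
      (f := τ WalkingSeq.quo) (g := τ WalkingSeq.quo) (fun j => (h.prop_diag_obj j).2)
      hK hD hD hE (nat _) (nat _) (nat _) (nat _)⟩

/-- A presentation of the quotient map by morphisms from `Q` extends to the whole sequence by
adjoining levelwise kernel pairs; their colimit is the given kernel pair because pullbacks commute
with `κ`-filtered colimits. -/
theorem kDirectedColimits_of_isPSequence (hQ : IsQEEpiClass Q) {F : WalkingSeq ⥤ A}
    (hF : IsPSequence (directedColimitClass κ Q) F) :
    kDirectedColimits κ (fun G : WalkingSeq ⥤ A => IsPSequence (directedColimitClass κ Q) G ∧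
      ∀ j, IsCardinalPresentable (G.obj j) κ) F := by
  obtain ⟨hp, hk⟩ := hF
  obtain ⟨J, _, _, X, Y, α, c, d, ⟨hc⟩, ⟨hd⟩, hα, h⟩ := hp.exists_natTrans
  have hX (j : J) : IsCardinalPresentable (X.obj j) κ := (hα j).presentable_left
  have hY (j : J) : IsCardinalPresentable (Y.obj j) κ := (hα j).presentable_right
  have (j : J) : HasPullback (α.app j) (α.app j) := (hα j).hasPullback hQ _
  -- Built as a sequence of functors on `J`, then flipped.
  let G : J ⥤ WalkingSeq ⥤ A := (WalkingSeq.lift (pullbackFunctorFst α α) (pullbackFunctorSnd α α) α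
    (by ext j; exact pullback.condition)).flip
  have e (j : J) : (pullback.fst (α.app j) (α.app j) ≫ c.app j) ≫ F.map WalkingSeq.quo =
      (pullback.snd (α.app j) (α.app j) ≫ c.app j) ≫ F.map WalkingSeq.quo := by
    rw [Category.assoc, Category.assoc, h, pullback.condition_assoc]
  let l (j : J) : (pullbackFunctor α α).obj j ⟶ F.obj WalkingSeq.K := hk.lift _ _ (e j)
  have l₁ (j : J) : l j ≫ F.map WalkingSeq.fst = pullback.fst (α.app j) (α.app j) ≫ c.app j :=
    hk.lift_fst _ _ _
  have l₂ (j : J) : l j ≫ F.map WalkingSeq.snd = pullback.snd (α.app j) (α.app j) ≫ c.app j :=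
    hk.lift_snd _ _ _
  let ι (j : J) : G.obj j ⟶ F := WalkingSeq.natTrans (l j) (c.app j) (d.app j)
    (l₁ j).symm (l₂ j).symm (h j).symm
  have hι {i j : J} (φ : i ⟶ j) : G.map φ ≫ ι j = ι i := by
    ext x
    have hc' : X.map φ ≫ c.app j = c.app i := (c.naturality φ).trans (Category.comp_id _)
    have hd' : Y.map φ ≫ d.app j = d.app i := (d.naturality φ).trans (Category.comp_id _)
    cases x with
    | K =>
      change (pullbackFunctor α α).map φ ≫ l j = l i
      refine hk.hom_ext ?_ ?_
      · rw [Category.assoc, l₁, l₁]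
        exact (pullback.lift_fst_assoc _ _ _ _).trans
          ((Category.assoc _ _ _).trans (congr_arg (pullback.fst _ _ ≫ ·) hc'))
      · rw [Category.assoc, l₂, l₂]
        exact (pullback.lift_snd_assoc _ _ _ _).trans
          ((Category.assoc _ _ _).trans (congr_arg (pullback.snd _ _ ≫ ·) hc'))
    | D => exact hc'
    | E => exact hd'
  let t : Cocone G :=
    { pt := F
      ι := { app := ι
             naturality i j φ := (hι φ).trans (Category.comp_id _).symm } }
  have ht : IsColimit t := evaluationJointlyReflectsColimits _ fun x => Nonempty.some <| by
    cases x with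
    | K =>
      exact nonempty_isColimit_of_isPullback κ
        (cP := ((evaluation _ _).obj WalkingSeq.K).mapCocone t) hc hc hd hk l₁ l₂ h h
    | D => exact ⟨hc⟩
    | E => exact ⟨hd⟩
  refine ⟨J, inferInstance, inferInstance, ⟨⟨⟨G, t.ι, ht⟩, fun j =>
    ⟨⟨(hα j).directedColimitClass, isPullback_pullbackFunctor_app α α j⟩, fun x => ?_⟩⟩⟩⟩
  cases x with
  | K => exact (hα j).presentable_of_isPullback hQ (isPullback_pullbackFunctor_app α α j)
  | D => exact hX j
  | E => exact hY j

end

theorem theorem9p1 {A : Type u} [Category.{w} A] (κ : Cardinal.{w}) [Fact κ.IsRegular]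
    [IsCardinalAccessibleCategory A κ]
    (Q : MorphismProperty (isCardinalPresentable A κ).FullSubcategory)
    (hQ : IsQEEpiClass Q) :
    IsStronglyLocallyCoherentQEEpiClass κ (directedColimitClass κ Q) where
  toIsQEEpiClass := isQEEpiClass_directedColimitClass hQ
  -- For the converse, presentability of the terms is dropped: the class of all sequences is closed
  -- under `κ`-directed colimits.
  isPSequence_iff _ := ⟨kDirectedColimits_of_isPSequence hQ, fun ⟨J, _, _, hF⟩ =>
    isPSequence_of_kDirectedColimits
      ⟨J, _, ‹_›, ObjectProperty.colimitsOfShape_monotone J (fun _ h => h.1) _ hF⟩⟩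
  isCardinalPresentable_of_isPullback sq hp _ _ _ :=
    directedColimitClass_presentable_of_isPullback hQ sq hp
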